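/- Let $n,k\ge 2$ and $r:=\min(n,k)$. Let $D_{n,k}$ be the set of density operators (positive-semidefinite matrices of unit trace) on $\mathbb C^n\otimes\mathbb C^k$. For $X\in M_n(\mathbb C)\otimes M_k(\mathbb C)$ let $X^\Gamma:=(\mathrm{id}_n\otimes\Theta)(X)$ be the partial transpose, where $\Theta$ is the transposition on $M_k(\mathbb C)$. Put $$\mathrm{PPT}_{n,k}:=\{\rho\in D_{n,k} : \rho^\Gamma\ge 0\},\qquad \mathrm{APPT}_{n,k}:=\bigcap_{U\in\mathcal U_{nk}} U\,\mathrm{PPT}_{n,k}\,U^*,$$ where $\mathcal U_{nk}$ is the group of unitary operators on $\mathbb C^n\otimes\mathbb C^k$ (absolutely PPT states). Theorem. Let $\rho\in D_{n,k}$ have the decreasingly ordered eigenvalue vector $\lambda=(\lambda_1\ge\dots\ge\lambda_{nk})$, counted with multiplicity. If $$\sum_{i=1}^{r-1}\lambda_i\ \le\ 2\lambda_{nk}+\sum_{i=1}^{r-1}\lambda_{nk-i},$$ then $\rho\in\mathrm{APPT}_{n,k}$. In other words, $\mathrm{GER}_{n,k}\subseteq\mathrm{APPT}_{n,k}$, where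 $$\mathrm{GER}_{n,k}:=\Big\{\lambda\in\mathbb R^{nk} : \lambda_i\ge0,\ \sum_{i=1}^{nk}\lambda_i=1,\ \sum_{i=1}^{r-1}\lambda^\downarrow_i\le 2\lambda^\downarrow_{nk}+\sum_{i=1}^{r-1}\lambda^\downarrow_{nk-i}\Big\},$$ $\lambda^\downarrow$ is the decreasing rearrangement of $\lambda$, and $\mathrm{GER}_{n,k}$ is identified with the set of density operators in $D_{n,k}$ whose spectrum (with multiplicities) lies in it. -/

import Mathlib

open scoped ComplexOrder Kronecker

namespace AbsolutelyPPT

/-- Complex matrices acting on `ℂⁿ ⊗ ℂᵏ`; rows and columns are indexed by pairs. -/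
abbrev BipartiteMatrix (n k : ℕ) : Type := Matrix (Fin n × Fin k) (Fin n × Fin k) ℂ

/-- The set `D_{n,k}` of density operators on `ℂⁿ ⊗ ℂᵏ`. -/
def densityOperators (n k : ℕ) : Set (BipartiteMatrix n k) :=
  {ρ | ρ.PosSemidef ∧ ρ.trace = 1}

/-- The partial transposition `X^Γ = (id_n ⊗ Θ)(X)`: the second tensor factor is transposed. -/
def partialTranspose {n k : ℕ} (X : BipartiteMatrix n k) : BipartiteMatrix n k :=
  Matrix.of fun p q => X (p.1, q.2) (q.1, p.2)

theorem partialTranspose_kronecker {n k : ℕ} (A : Matrix (Fin n) (Fin n) ℂ)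
    (B : Matrix (Fin k) (Fin k) ℂ) : partialTranspose (A ⊗ₖ B) = A ⊗ₖ B.transpose := by
  ext p q
  rfl

/-- States with positive-semidefinite partial transpose. -/
def PPT (n k : ℕ) : Set (BipartiteMatrix n k) :=
  {ρ | ρ ∈ densityOperators n k ∧ (partialTranspose ρ).PosSemidef}

/-- Absolutely PPT states: `⋂_U U · PPT · U*`, over all unitaries `U` on `ℂⁿ ⊗ ℂᵏ`. -/
def APPT (n k : ℕ) : Set (BipartiteMatrix n k) :=
  ⋂ U ∈ Matrix.unitaryGroup (Fin n × Fin k) ℂ,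
    (fun ρ : BipartiteMatrix n k => U * ρ * U.conjTranspose) '' PPT n k

/-- The probability simplex in `ℝᵈ`. -/
def simplex (d : ℕ) : Set (Fin d → ℝ) :=
  {x | (∀ i, 0 ≤ x i) ∧ ∑ i, x i = 1}

/-- The decreasing rearrangement `x^↓` of a real vector `x`. -/
noncomputable def decr {d : ℕ} (x : Fin d → ℝ) : Fin d → ℝ :=
  x ∘ Tuple.sort (fun i => -x i)

theorem decr_antitone {d : ℕ} (x : Fin d → ℝ) : Antitone (decr x) := by
  intro i j hij
  exact neg_le_neg_iff.mp (Tuple.monotone_sort (fun i => -x i) hij)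

/-- The entry `x_i` in one-based indexing, `1 ≤ i ≤ d`. (It is only used for such `i`.) -/
noncomputable def entry {d : ℕ} (x : Fin d → ℝ) (i : ℕ) : ℝ :=
  if h : 1 ≤ i ∧ i ≤ d then x ⟨i - 1, by omega⟩ else 0

/-- `∑_{i=1}^{r-1} x_i ≤ 2 x_{nk} + ∑_{i=1}^{r-1} x_{nk-i}` with `r = min(n,k)`. -/
def GershgorinInequality (n k : ℕ) (x : Fin (n * k) → ℝ) : Prop :=
  ∑ i ∈ Finset.Icc 1 (min n k - 1), entry x i
    ≤ 2 * entry x (n * k) + ∑ i ∈ Finset.Icc 1 (min n k - 1), entry x (n * k - i)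

/-- The set `GER_{n,k}` of spectra. -/
def GER (n k : ℕ) : Set (Fin (n * k) → ℝ) :=
  {x | x ∈ simplex (n * k) ∧ GershgorinInequality n k (decr x)}

/-- `x` lists the eigenvalues of `X`, each according to its algebraic multiplicity. -/
def IsEigenvalueVector {n k : ℕ} (X : BipartiteMatrix n k) (x : Fin (n * k) → ℝ) : Prop :=
  X.charpoly.roots = Finset.univ.val.map (fun i => (x i : ℂ))

/-- The set of density operators whose spectrum (with multiplicities) lies in the
permutation-invariant set `A`. -/
def statesWithSpectrumIn (n k : ℕ) (A : Set (Fin (n * k) → ℝ)) : Set (BipartiteMatrix n k) :=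
  {ρ | ρ ∈ densityOperators n k ∧ ∃ x ∈ A, IsEigenvalueVector ρ x}

end AbsolutelyPPT

namespace AbsolutelyPPT

/-! ### Ky Fan inequalities -/

/-! Unitary conjugation preserves the spectrum, so it suffices to show `ρ ∈ PPT n k`. For `v = ∑ s_i
e_i ⊗ f_i` in Schmidt form, put `g_ij = e_i ⊗ conj f_j`; the `g_ij` are orthonormal and `⟨v, ρ^Γ v⟩
= ∑ s_i s_j ⟨g_ij, ρ g_ji⟩` (`dotProduct_partialTranspose`). It remains to see that the real
symmetric matrix `C_ij = Re ⟨g_ij, ρ g_ji⟩` is diagonally dominant (`sum_abs_re_inner_flip_le`), as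
in Gershgorin's theorem.

By polarization, `2 |C_ij|` is the difference of the quadratic form of `ρ` at `(g_ij ± g_ji)/√2`,
with suitable signs. Over `j ≠ i`, Ky Fan bounds the larger values by the top eigenvalues, and the
smaller values together with `C_ii` from below by the bottom ones. The hypothesis then gives `2 ∑
|C_ij| ≤ λ_N + C_ii ≤ 2 C_ii`, where `N = nk`. -/

theorem sum_mul_le_sum_of_threshold {ι : Type*} [Fintype ι] (c x : ι → ℝ) (T : Finset ι) (θ : ℝ)
    (hc0 : ∀ j, 0 ≤ c j) (hc1 : ∀ j, c j ≤ 1) (hsum : ∑ j, c j = T.card)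
    (hT : ∀ j ∈ T, θ ≤ x j) (hT' : ∀ j ∉ T, x j ≤ θ) :
    ∑ j, c j * x j ≤ ∑ j ∈ T, x j := by
  classical
  -- Both sides carry total weight `T.card`, so shifting `x` by `θ` changes them equally.
  have h : ∑ j, c j * (x j - θ) ≤ ∑ j ∈ T, (x j - θ) := by
    rw [← Finset.sum_filter_add_sum_filter_not Finset.univ (· ∈ T)]
    rw [Finset.filter_mem_eq_inter, Finset.univ_inter]
    have h1 : ∑ j ∈ T, c j * (x j - θ) ≤ ∑ j ∈ T, (x j - θ) :=
      Finset.sum_le_sum fun j hj => mul_le_of_le_one_left (sub_nonneg.2 (hT j hj)) (hc1 j)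
    have h2 : ∑ j ∈ Finset.univ.filter (· ∉ T), c j * (x j - θ) ≤ 0 :=
      Finset.sum_nonpos fun j hj =>
        mul_nonpos_of_nonneg_of_nonpos (hc0 j) (sub_nonpos.2 (hT' j (Finset.mem_filter.1 hj).2))
    linarith
  simp only [mul_sub, Finset.sum_sub_distrib, ← Finset.sum_mul, hsum, Finset.sum_const,
    nsmul_eq_mul] at h
  linarith

theorem entry_of_lt {d : ℕ} (x : Fin d → ℝ) (i : Fin d) : entry x (i + 1) = x i := by
  have h : 1 ≤ (i : ℕ) + 1 ∧ (i : ℕ) + 1 ≤ d := ⟨by omega, i.2⟩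
  rw [entry, dif_pos h]
  congr 1

theorem sum_filter_lt_eq_sum_entry {N t : ℕ} (ht : t ≤ N) (x : Fin N → ℝ) :
    ∑ j ∈ Finset.univ.filter (fun j : Fin N => (j : ℕ) < t), x j
      = ∑ i ∈ Finset.Icc 1 t, entry x i := by
  refine Finset.sum_bij (fun j _ => (j : ℕ) + 1) ?_ ?_ ?_ ?_
  · intro j hj
    simp only [Finset.mem_filter, Finset.mem_univ, true_and] at hj
    simp only [Finset.mem_Icc]
    omega
  · intro i _ j _ h
    exact Fin.ext (by simpa using h)
  · intro i hi
    rw [Finset.mem_Icc] at hi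
    exact ⟨⟨i - 1, by omega⟩, by simp; omega, by simp; omega⟩
  · intro j _
    rw [entry_of_lt]

theorem sum_filter_ge_eq_sum_entry {N t : ℕ} (ht : t ≤ N) (x : Fin N → ℝ) :
    ∑ j ∈ Finset.univ.filter (fun j : Fin N => N - t ≤ (j : ℕ)), x j
      = ∑ i ∈ Finset.range t, entry x (N - i) := by
  refine Finset.sum_bij (fun j _ => N - 1 - (j : ℕ)) ?_ ?_ ?_ ?_
  · intro j hj
    have := j.2
    simp only [Finset.mem_filter, Finset.mem_univ, true_and] at hj
    simp only [Finset.mem_range]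
    omega
  · intro i _ j _ h
    have := i.2
    have := j.2
    exact Fin.ext (by omega)
  · intro i hi
    rw [Finset.mem_range] at hi
    exact ⟨⟨N - 1 - i, by omega⟩, by simp; omega, by simp; omega⟩
  · intro j _
    have := j.2
    rw [show N - (N - 1 - (j : ℕ)) = j + 1 by omega, entry_of_lt]

section KyFan

variable {E : Type*} [NormedAddCommGroup E] [InnerProductSpace ℂ E] {N : ℕ}
  (b : OrthonormalBasis (Fin N) ℂ E) {T : E →ₗ[ℂ] E} {lam : Fin N → ℝ}

theorem re_inner_map_self_eq_sum (hT : ∀ j, T (b j) = (lam j : ℂ) • b j) (x : E) :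
    (inner ℂ x (T x)).re = ∑ j, ‖inner ℂ (b j) x‖ ^ 2 * lam j := by
  have h : T x = ∑ j, (inner ℂ (b j) x * lam j) • b j := by
    conv_lhs => rw [← b.sum_repr' x]
    simp only [map_sum, map_smul, hT, smul_smul]
  rw [h, inner_sum, Complex.re_sum]
  refine Finset.sum_congr rfl fun j _ => ?_
  rw [inner_smul_right, ← inner_conj_symm x (b j), mul_right_comm, Complex.mul_conj,
    Complex.normSq_eq_norm_sq, ← Complex.ofReal_mul, Complex.ofReal_re]

variable {ι : Type*} [Fintype ι] {u : ι → E}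

theorem sum_sum_norm_inner_sq (hu : Orthonormal ℂ u) :
    ∑ j, ∑ i, ‖inner ℂ (b j) (u i)‖ ^ 2 = Fintype.card ι := by
  rw [Finset.sum_comm]
  simp [b.sum_sq_norm_inner_right, hu.1]

theorem sum_norm_inner_sq_le_one (hu : Orthonormal ℂ u) (j : Fin N) :
    ∑ i, ‖inner ℂ (b j) (u i)‖ ^ 2 ≤ 1 := by
  have h := hu.sum_inner_products_le (b j) (s := Finset.univ)
  simp only [b.norm_eq_one, one_pow] at h
  simpa only [norm_inner_symm] using h

include b in
theorem card_le_of_orthonormal (hu : Orthonormal ℂ u) : Fintype.card ι ≤ N := by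
  have : FiniteDimensional ℂ E := b.toBasis.finiteDimensional_of_finite
  have h := hu.linearIndependent.fintype_card_le_finrank
  rwa [Module.finrank_eq_card_basis b.toBasis, Fintype.card_fin] at h

theorem sum_re_inner_eq (hT : ∀ j, T (b j) = (lam j : ℂ) • b j) :
    ∑ i, (inner ℂ (u i) (T (u i))).re = ∑ j, (∑ i, ‖inner ℂ (b j) (u i)‖ ^ 2) * lam j := by
  simp_rw [re_inner_map_self_eq_sum b hT, Finset.sum_mul]
  exact Finset.sum_comm

/-- Ky Fan: an orthonormal family of size `t` sees at most the `t` largest eigenvalues. -/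
theorem sum_re_inner_le (hT : ∀ j, T (b j) = (lam j : ℂ) • b j) (hlam : Antitone lam)
    (hu : Orthonormal ℂ u) :
    ∑ i, (inner ℂ (u i) (T (u i))).re ≤ ∑ i ∈ Finset.Icc 1 (Fintype.card ι), entry lam i := by
  have hN := card_le_of_orthonormal b hu
  rw [sum_re_inner_eq b hT, ← sum_filter_lt_eq_sum_entry hN]
  rcases Nat.eq_zero_or_pos (Fintype.card ι) with h0 | h0
  · have : IsEmpty ι := Fintype.card_eq_zero_iff.1 h0
    simp
  have hcard : (Finset.univ.filter (fun j : Fin N => (j : ℕ) < Fintype.card ι)).card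
      = Fintype.card ι := by
    rw [Finset.card_filter, Fin.sum_univ_eq_sum_range (fun i => if i < Fintype.card ι then 1 else 0),
      ← Finset.card_filter]
    rw [show (Finset.range N).filter (· < Fintype.card ι) = Finset.range (Fintype.card ι) by
      ext; simp; omega, Finset.card_range]
  -- The weights are at most 1 by Bessel and sum to the size of the family by Parseval.
  refine sum_mul_le_sum_of_threshold _ lam _ (lam ⟨Fintype.card ι - 1, by omega⟩)
    (fun j => Finset.sum_nonneg fun _ _ => by positivity) (sum_norm_inner_sq_le_one b hu)
    (by rw [sum_sum_norm_inner_sq b hu, hcard]) ?_ ?_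
  · intro j hj
    simp only [Finset.mem_filter, Finset.mem_univ, true_and] at hj
    exact hlam (Fin.mk_le_mk.2 (by omega) : (j : Fin N) ≤ ⟨Fintype.card ι - 1, _⟩)
  · intro j hj
    simp only [Finset.mem_filter, Finset.mem_univ, true_and] at hj
    exact hlam (Fin.mk_le_mk.2 (by omega) : ⟨Fintype.card ι - 1, _⟩ ≤ j)

/-- Ky Fan: an orthonormal family of size `t` sees at least the `t` smallest eigenvalues. -/
theorem le_sum_re_inner (hT : ∀ j, T (b j) = (lam j : ℂ) • b j) (hlam : Antitone lam)
    (hu : Orthonormal ℂ u) :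
    ∑ i ∈ Finset.range (Fintype.card ι), entry lam (N - i)
      ≤ ∑ i, (inner ℂ (u i) (T (u i))).re := by
  have hN := card_le_of_orthonormal b hu
  rw [sum_re_inner_eq b hT, ← sum_filter_ge_eq_sum_entry hN]
  rcases Nat.eq_zero_or_pos (Fintype.card ι) with h0 | h0
  · have : IsEmpty ι := Fintype.card_eq_zero_iff.1 h0
    refine le_of_eq ?_
    simp only [Finset.univ_eq_empty, Finset.sum_empty, zero_mul, Finset.sum_const_zero]
    refine Finset.sum_eq_zero fun j hj => ?_
    have := j.2
    simp only [Finset.mem_filter, Finset.mem_univ, true_and] at hj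
    omega
  have hcard : (Finset.univ.filter (fun j : Fin N => N - Fintype.card ι ≤ (j : ℕ))).card
      = Fintype.card ι := by
    rw [Finset.card_filter,
      Fin.sum_univ_eq_sum_range (fun i => if N - Fintype.card ι ≤ i then 1 else 0),
      ← Finset.card_filter]
    rw [show (Finset.range N).filter (N - Fintype.card ι ≤ ·)
      = Finset.Ico (N - Fintype.card ι) N by ext; simp; omega, Nat.card_Ico]
    omega
  -- For `-lam` the last indices carry the largest values.
  have key := sum_mul_le_sum_of_threshold (fun j => ∑ i, ‖inner ℂ (b j) (u i)‖ ^ 2)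
    (fun j => -lam j) _ (-lam ⟨N - Fintype.card ι, by omega⟩)
    (fun j => Finset.sum_nonneg fun _ _ => by positivity) (sum_norm_inner_sq_le_one b hu)
    (by rw [sum_sum_norm_inner_sq b hu, hcard]) ?_ ?_
  · simp only [mul_neg, Finset.sum_neg_distrib] at key
    linarith
  · intro j hj
    simp only [Finset.mem_filter, Finset.mem_univ, true_and] at hj
    exact neg_le_neg (hlam (Fin.mk_le_mk.2 (by omega) : ⟨N - Fintype.card ι, _⟩ ≤ j))
  · intro j hj
    simp only [Finset.mem_filter, Finset.mem_univ, true_and] at hj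
    exact neg_le_neg (hlam (Fin.mk_le_mk.2 (by omega) : (j : Fin N) ≤ ⟨N - Fintype.card ι, _⟩))

end KyFan

/-! ### Diagonal dominance of the flipped quadratic form -/

section Flip

variable {E : Type*} [NormedAddCommGroup E] [InnerProductSpace ℂ E]
  {ι : Type*} [DecidableEq ι]

/-- The vectors `(g_ij + ε_j g_ji) / √2` for `j ≠ i`, and `g_ii` for `j = i`. -/
noncomputable def signedSwap (g : ι × ι → E) (ε : ι → ℝ) (i j : ι) : E :=
  if j = i then g (i, i) else ((√2 : ℝ) : ℂ)⁻¹ • (g (i, j) + (ε j : ℂ) • g (j, i))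

theorem inv_sqrt_two_mul_self : ((√2 : ℝ) : ℂ)⁻¹ * ((√2 : ℝ) : ℂ)⁻¹ = 1 / 2 := by
  rw [← mul_inv, ← Complex.ofReal_mul, Real.mul_self_sqrt (by norm_num)]
  norm_num

/-- With `i` fixed, different `j` involve disjoint sets of the vectors `g (i, j)`, `g (j, i)`. -/
theorem orthonormal_signedSwap {g : ι × ι → E} (hg : Orthonormal ℂ g) {ε : ι → ℝ}
    (hε : ∀ j, ε j * ε j = 1) (i : ι) : Orthonormal ℂ (signedSwap g ε i) := by
  rw [orthonormal_iff_ite] at hg ⊢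
  intro j l
  by_cases hj : j = i <;> by_cases hl : l = i
  · rw [hj, hl]
    simp only [signedSwap, if_true, hg]
  · have : ¬ i = l := fun h => hl h.symm
    simp [signedSwap, hj, hl, hg, inner_add_right, inner_smul_right, this]
  · simp [signedSwap, hj, hl, hg, inner_add_left, inner_smul_left]
  · have hj' : ¬ i = j := fun h => hj h.symm
    have hl' : ¬ i = l := fun h => hl h.symm
    have hc : (ε j : ℂ) * ε j = 1 := by exact_mod_cast hε j
    by_cases hjl : j = l
    · subst hjl
      simp only [signedSwap, hj, hj', if_false, inner_smul_left, inner_smul_right, inner_add_left,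
        inner_add_right, hg, map_inv₀, Complex.conj_ofReal, Prod.mk.injEq, and_self, if_true]
      linear_combination (2 : ℂ) * inv_sqrt_two_mul_self +
        ((√2 : ℝ) : ℂ)⁻¹ * ((√2 : ℝ) : ℂ)⁻¹ * hc
    · simp [signedSwap, hj, hl, hl', hjl, inner_smul_left, inner_smul_right,
        inner_add_left, inner_add_right, hg]

/-- Only the cross term depends on `ε`, so replacing `ε` by `-ε` isolates it. -/
theorem re_inner_signedSwap {T : E →ₗ[ℂ] E} (hT : T.IsSymmetric) (g : ι × ι → E) {ε : ι → ℝ}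
    (hε : ∀ j, ε j * ε j = 1) {i j : ι} (hj : j ≠ i) :
    (inner ℂ (signedSwap g ε i j) (T (signedSwap g ε i j))).re
      = ((inner ℂ (g (i, j)) (T (g (i, j)))).re + (inner ℂ (g (j, i)) (T (g (j, i)))).re) / 2
        + ε j * (inner ℂ (g (i, j)) (T (g (j, i)))).re := by
  have hc : (ε j : ℂ) * ε j = 1 := by exact_mod_cast hε j
  have hsym : (inner ℂ (g (j, i)) (T (g (i, j)))).re = (inner ℂ (g (i, j)) (T (g (j, i)))).re := by
    rw [← hT, ← inner_conj_symm, Complex.conj_re]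
  have h : inner ℂ (signedSwap g ε i j) (T (signedSwap g ε i j))
      = (1 / 2 : ℝ) * (inner ℂ (g (i, j)) (T (g (i, j))) + inner ℂ (g (j, i)) (T (g (j, i))))
        + (ε j / 2 : ℝ) * (inner ℂ (g (i, j)) (T (g (j, i))) + inner ℂ (g (j, i)) (T (g (i, j)))) := by
    simp only [signedSwap, hj, if_false, map_smul, map_add, inner_smul_left, inner_smul_right,
      inner_add_left, inner_add_right, map_inv₀, Complex.conj_ofReal]
    push_cast
    set A := inner ℂ (g (i, j)) (T (g (i, j)))
    set B := inner ℂ (g (j, i)) (T (g (j, i)))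
    set C := inner ℂ (g (i, j)) (T (g (j, i)))
    set D := inner ℂ (g (j, i)) (T (g (i, j)))
    linear_combination (A + ε j * C + ε j * D + ε j * ε j * B) * inv_sqrt_two_mul_self
      + 1 / 2 * B * hc
  rw [h, Complex.add_re, Complex.re_ofReal_mul, Complex.re_ofReal_mul, Complex.add_re,
    Complex.add_re, hsym]
  ring

variable [Fintype ι] {N : ℕ} (b : OrthonormalBasis (Fin N) ℂ E) {T : E →ₗ[ℂ] E} {lam : Fin N → ℝ}

theorem sum_abs_re_inner_flip_le (hT : ∀ j, T (b j) = (lam j : ℂ) • b j) (hTs : T.IsSymmetric)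
    (hlam : Antitone lam)
    (hger : ∑ i ∈ Finset.Icc 1 (Fintype.card ι - 1), entry lam i
      ≤ 2 * entry lam N + ∑ i ∈ Finset.Icc 1 (Fintype.card ι - 1), entry lam (N - i))
    {g : ι × ι → E} (hg : Orthonormal ℂ g) (i : ι) :
    ∑ j ∈ Finset.univ.erase i, |(inner ℂ (g (i, j)) (T (g (j, i)))).re|
      ≤ (inner ℂ (g (i, i)) (T (g (i, i)))).re := by
  set Q : E → ℝ := fun x => (inner ℂ x (T x)).re
  set B : ι → ℝ := fun j => (inner ℂ (g (i, j)) (T (g (j, i)))).re with hB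
  set ε : ι → ℝ := fun j => if 0 ≤ B j then 1 else -1 with hεdef
  have hε : ∀ j, ε j * ε j = 1 := fun j => by simp only [hεdef]; split_ifs <;> norm_num
  have hε' : ∀ j, (-ε) j * (-ε) j = 1 := fun j => by simpa using hε j
  have habs : ∀ j, ε j * B j = |B j| := fun j => by
    simp only [hεdef]
    split_ifs with h
    · rw [abs_of_nonneg h, one_mul]
    · rw [abs_of_neg (not_le.1 h)]; ring
  -- The upper bound omits `j = i`, while the lower bound keeps it: this places `g (i, i)` beside
  -- the `-ε` vectors and yields one more small eigenvalue.
  have hpos : 0 < Fintype.card ι := Fintype.card_pos_iff.2 ⟨i⟩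
  have hup := sum_re_inner_le b hT hlam
    ((orthonormal_signedSwap hg hε i).comp (Subtype.val : {j // j ≠ i} → ι)
      Subtype.val_injective)
  have hlow := le_sum_re_inner b hT hlam (orthonormal_signedSwap hg hε' i)
  have hone := le_sum_re_inner b hT hlam
    (hg.comp (fun _ : Unit => (i, i)) (Function.injective_of_subsingleton _))
  have hcard : Fintype.card {j // j ≠ i} = Fintype.card ι - 1 := by
    rw [Fintype.card_subtype_compl, Fintype.card_subtype_eq]
  simp only [Function.comp_apply] at hup
  rw [hcard, ← Finset.sum_subtype (Finset.univ.erase i) (by simp)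
    (fun j => Q (signedSwap g ε i j))] at hup
  have hrange : ∑ i ∈ Finset.range (Fintype.card ι), entry lam (N - i)
      = entry lam N + ∑ i ∈ Finset.Icc 1 (Fintype.card ι - 1), entry lam (N - i) := by
    rw [Finset.range_eq_Ico, Finset.sum_eq_sum_Ico_succ_bot hpos, Nat.sub_zero]
    congr 2
  rw [hrange, ← Finset.add_sum_erase _ _ (Finset.mem_univ i)] at hlow
  have hii : signedSwap g (-ε) i i = g (i, i) := by simp [signedSwap]
  rw [hii] at hlow
  simp only [Fintype.card_unit, Finset.range_one, Finset.sum_singleton, Nat.sub_zero,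
    Finset.univ_unique, Function.comp_apply] at hone
  have hdiff : ∑ j ∈ Finset.univ.erase i, Q (signedSwap g ε i j)
      - ∑ j ∈ Finset.univ.erase i, Q (signedSwap g (-ε) i j)
      = 2 * ∑ j ∈ Finset.univ.erase i, |B j| := by
    rw [← Finset.sum_sub_distrib, Finset.mul_sum]
    refine Finset.sum_congr rfl fun j hj => ?_
    have hji := Finset.ne_of_mem_erase hj
    simp only [Q]
    rw [re_inner_signedSwap hTs g hε hji, re_inner_signedSwap hTs g hε' hji, Pi.neg_apply,
      ← habs j]
    simp only [hB]
    ring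
  change _ ≤ Q (g (i, i))
  change entry lam N ≤ Q (g (i, i)) at hone
  change _ ≤ Q (g (i, i)) + ∑ j ∈ Finset.univ.erase i, Q (signedSwap g (-ε) i j) at hlow
  linarith

/-- Diagonal dominance gives positivity through `2 |s_i s_j| ≤ s_i² + s_j²`. -/
theorem flip_form_nonneg (hT : ∀ j, T (b j) = (lam j : ℂ) • b j) (hTs : T.IsSymmetric)
    (hlam : Antitone lam)
    (hger : ∑ i ∈ Finset.Icc 1 (Fintype.card ι - 1), entry lam i
      ≤ 2 * entry lam N + ∑ i ∈ Finset.Icc 1 (Fintype.card ι - 1), entry lam (N - i))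
    {g : ι × ι → E} (hg : Orthonormal ℂ g) (s : ι → ℝ) :
    0 ≤ ∑ i, ∑ j, s i * s j * (inner ℂ (g (i, j)) (T (g (j, i)))).re := by
  set C : ι → ι → ℝ := fun i j => (inner ℂ (g (i, j)) (T (g (j, i)))).re
  have hrow : ∀ i, ∑ j ∈ Finset.univ.erase i, |C i j| ≤ C i i :=
    sum_abs_re_inner_flip_le b hT hTs hlam hger hg
  have hsymm : ∀ i j, C i j = C j i := fun i j => by
    simp only [C]
    rw [← hTs, ← inner_conj_symm, Complex.conj_re]
  have hrow' : ∀ i, ∑ j, |C i j| ≤ 2 * C i i := fun i => by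
    have h0 : 0 ≤ C i i := (Finset.sum_nonneg fun _ _ => abs_nonneg _).trans (hrow i)
    rw [← Finset.add_sum_erase _ _ (Finset.mem_univ i), abs_of_nonneg h0]
    linarith [hrow i]
  -- The diagonal term `4 s_i² C_ii` makes the case `i = j` an equality, so the sum can run over all
  -- pairs.
  have hterm : ∀ i j, 2 * (if i = j then s i ^ 2 * C i i else 0) * 2
      - s i ^ 2 * |C i j| - s j ^ 2 * |C j i| ≤ 2 * (s i * s j * C i j) := fun i j => by
    rw [← hsymm i j]
    by_cases hij : i = j
    · subst hij
      have h0 : 0 ≤ C i i := (Finset.sum_nonneg fun _ _ => abs_nonneg _).trans (hrow i)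
      rw [if_pos rfl, abs_of_nonneg h0]
      nlinarith
    · rw [if_neg hij]
      rcases abs_cases (C i j) with ⟨h, h'⟩ | ⟨h, h'⟩ <;> rw [h] <;>
        nlinarith [mul_nonneg (sq_nonneg (s i + s j)) (abs_nonneg (C i j)),
          mul_nonneg (sq_nonneg (s i - s j)) (abs_nonneg (C i j))]
  have hsum := Finset.sum_le_sum fun i (_ : i ∈ Finset.univ) =>
    Finset.sum_le_sum fun j (_ : j ∈ Finset.univ) => hterm i j
  have h1 : ∑ i, ∑ j, s i ^ 2 * |C i j| ≤ ∑ i, 2 * (s i ^ 2 * C i i) :=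
    Finset.sum_le_sum fun i _ => by
      rw [← Finset.mul_sum]
      nlinarith [mul_le_mul_of_nonneg_left (hrow' i) (sq_nonneg (s i))]
  have h2 : ∑ i, ∑ j, s j ^ 2 * |C j i| = ∑ i, ∑ j, s i ^ 2 * |C i j| := Finset.sum_comm
  simp only [Finset.sum_sub_distrib, ← Finset.mul_sum, ← Finset.sum_mul, Finset.sum_ite_eq,
    Finset.mem_univ, if_true] at hsum h1 h2
  linarith

end Flip

/-! ### Schmidt decomposition -/

section Schmidt

variable {m n : Type} [Fintype m] [Fintype n] [DecidableEq m]

/-- Schmidt decomposition of a bipartite vector, written as a matrix of coefficients. -/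
theorem exists_schmidt_decomposition (V : Matrix m n ℂ) :
    ∃ (S : Finset m) (s : S → ℝ) (e : S → EuclideanSpace ℂ m) (f : S → EuclideanSpace ℂ n),
      Orthonormal ℂ e ∧ Orthonormal ℂ f ∧ ∀ a b, V a b = ∑ i, s i * e i a * f i b := by
  classical
  have hA : (V * V.conjTranspose).IsHermitian := Matrix.isHermitian_mul_conjTranspose_self V
  set e := hA.eigenvectorBasis with he
  -- These are the coefficients of the columns of `V` in an eigenbasis of `V V*`. They are
  -- orthogonal because `⟨w_i, w_j⟩ = ⟨e_j, V V* e_i⟩`; the nonzero ones, normalized, give `f`.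
  let w : m → EuclideanSpace ℂ n := fun i => WithLp.toLp 2 fun b => ∑ a, star (e i a) * V a b
  have hV : ∀ a b, V a b = ∑ i, e i a * w i b := fun a b => by
    have h := congrArg (fun x : EuclideanSpace ℂ m => x a)
      (e.sum_repr' (WithLp.toLp 2 fun a => V a b))
    simp only [WithLp.ofLp_sum, Finset.sum_apply, WithLp.ofLp_smul,
      Pi.smul_apply, smul_eq_mul, PiLp.inner_apply, RCLike.inner_apply] at h
    rw [← h]
    refine Finset.sum_congr rfl fun i _ => ?_
    rw [mul_comm]
    congr 1
    exact Finset.sum_congr rfl fun a _ => mul_comm _ _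
  have hw : ∀ i j, i ≠ j → inner ℂ (w i) (w j) = 0 := fun i j hij => by
    have h1 : inner ℂ (e j) (WithLp.toLp 2 ((V * V.conjTranspose).mulVec (e i).ofLp)) = 0 := by
      rw [he, hA.mulVec_eigenvectorBasis, ← he, WithLp.toLp_smul, WithLp.toLp_ofLp,
        RCLike.real_smul_eq_coe_smul (K := ℂ), inner_smul_right,
        e.inner_eq_zero (Ne.symm hij), mul_zero]
    rw [← h1]
    simp only [PiLp.inner_apply, RCLike.inner_apply, w, Matrix.mulVec, dotProduct,
      Matrix.mul_apply, Matrix.conjTranspose_apply, map_sum, map_mul, Finset.sum_mul,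
      Finset.mul_sum, starRingEnd_apply, star_star]
    rw [Finset.sum_comm]
    simp_rw [Finset.sum_comm (s := (Finset.univ : Finset n))]
    rw [Finset.sum_comm]
    refine Finset.sum_congr rfl fun a _ => ?_
    refine Finset.sum_congr rfl fun c _ => ?_
    refine Finset.sum_congr rfl fun d _ => ?_
    ring
  refine ⟨Finset.univ.filter (fun i => w i ≠ 0), fun i => ‖w i‖, fun i => e i,
    fun i => ((‖w i‖ : ℝ) : ℂ)⁻¹ • w i, e.orthonormal.comp _ Subtype.val_injective, ?_, ?_⟩
  · refine ⟨fun i => ?_, fun i j hij => ?_⟩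
    · have hi : w i ≠ 0 := (Finset.mem_filter.1 i.2).2
      exact norm_smul_inv_norm hi
    · simp only
      rw [inner_smul_left, inner_smul_right, hw _ _ (fun h => hij (Subtype.ext h)), mul_zero,
        mul_zero]
  · intro a b
    rw [hV, ← Finset.sum_subset (Finset.filter_subset (fun i => w i ≠ 0) Finset.univ),
      ← Finset.sum_coe_sort]
    · refine Finset.sum_congr rfl fun i _ => ?_
      have hi : ((‖w i‖ : ℝ) : ℂ) ≠ 0 :=
        Complex.ofReal_ne_zero.2 (norm_ne_zero_iff.2 (Finset.mem_filter.1 i.2).2)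
      simp only [PiLp.smul_apply, smul_eq_mul]
      field_simp
    · intro i _ hi
      have : w i = 0 := by simpa using hi
      simp [this]

variable {ι : Type*} [DecidableEq ι]

/-- The product vectors `e_i ⊗ \bar f_j`. -/
noncomputable def conjProduct (e : ι → EuclideanSpace ℂ m) (f : ι → EuclideanSpace ℂ n)
    (x : ι × ι) : EuclideanSpace ℂ (m × n) :=
  WithLp.toLp 2 fun p => e x.1 p.1 * star (f x.2 p.2)

omit [DecidableEq m] in
theorem orthonormal_conjProduct {e : ι → EuclideanSpace ℂ m} {f : ι → EuclideanSpace ℂ n}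
    (he : Orthonormal ℂ e) (hf : Orthonormal ℂ f) : Orthonormal ℂ (conjProduct e f) := by
  rw [orthonormal_iff_ite] at he hf ⊢
  intro x y
  have h : inner ℂ (conjProduct e f x) (conjProduct e f y)
      = inner ℂ (e x.1) (e y.1) * inner ℂ (f y.2) (f x.2) := by
    simp only [conjProduct, PiLp.inner_apply, RCLike.inner_apply, Fintype.sum_prod_type,
      Finset.sum_mul_sum, map_mul, starRingEnd_apply, star_star]
    refine Finset.sum_congr rfl fun a _ => Finset.sum_congr rfl fun b _ => ?_
    ring
  rw [h, he, hf]
  by_cases h1 : x.1 = y.1 <;> by_cases h2 : x.2 = y.2 <;>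
    simp [Prod.ext_iff, h1, h2, Ne.symm]

end Schmidt

/-! ### The partial transpose in Schmidt coordinates -/

/-- Partial transposition swaps the second indices of row and column, so each `f` factor moves to
the other side of the inner product and is conjugated there. -/
theorem dotProduct_partialTranspose {n k : ℕ} (ρ : BipartiteMatrix n k) {ι : Type*} [Fintype ι]
    (s : ι → ℝ) (e : ι → EuclideanSpace ℂ (Fin n)) (f : ι → EuclideanSpace ℂ (Fin k))
    (v : Fin n × Fin k → ℂ) (hv : ∀ a b, v (a, b) = ∑ i, s i * e i a * f i b) :
    dotProduct (star v) ((partialTranspose ρ).mulVec v)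
      = ∑ i, ∑ j, ((s i * s j : ℝ) : ℂ) *
          inner ℂ (conjProduct e f (i, j)) (ρ.toEuclideanLin (conjProduct e f (j, i))) := by
  have hL : dotProduct (star v) ((partialTranspose ρ).mulVec v)
      = ∑ x : (Fin n × Fin k) × (Fin n × Fin k),
          star (v (x.1.1, x.2.2)) * ρ x.1 x.2 * v (x.2.1, x.1.2) := by
    simp only [dotProduct, Matrix.mulVec, Finset.mul_sum, ← Fintype.sum_prod_type']
    -- The reindexing is the involution that swaps the second-factor indices of row and column.
    refine Fintype.sum_equiv
      (⟨fun x => ((x.1.1, x.2.2), (x.2.1, x.1.2)), fun x => ((x.1.1, x.2.2), (x.2.1, x.1.2)),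
        fun _ => rfl, fun _ => rfl⟩ :
        ((Fin n × Fin k) × (Fin n × Fin k)) ≃ ((Fin n × Fin k) × (Fin n × Fin k))) _ _ ?_
    intro x
    simp [partialTranspose, mul_assoc]
  have hR : ∀ i j, inner ℂ (conjProduct e f (i, j)) (ρ.toEuclideanLin (conjProduct e f (j, i)))
      = ∑ x : (Fin n × Fin k) × (Fin n × Fin k),
          star (e i x.1.1) * f j x.1.2 * ρ x.1 x.2 * (e j x.2.1 * star (f i x.2.2)) := by
    intro i j
    rw [Fintype.sum_prod_type]
    simp only [PiLp.inner_apply, RCLike.inner_apply, Matrix.toLpLin_apply, conjProduct,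
      Matrix.mulVec, dotProduct, Finset.sum_mul, map_mul, starRingEnd_apply, star_star]
    refine Finset.sum_congr rfl fun p _ => Finset.sum_congr rfl fun q _ => ?_
    ring
  rw [hL]
  simp_rw [hR, Finset.mul_sum]
  simp_rw [Finset.sum_comm (t := (Finset.univ : Finset ((Fin n × Fin k) × (Fin n × Fin k))))]
  refine Finset.sum_congr rfl fun x _ => ?_
  rw [hv, hv, star_sum, mul_assoc, Finset.sum_mul]
  refine Finset.sum_congr rfl fun i _ => ?_
  rw [Finset.mul_sum, Finset.mul_sum]
  refine Finset.sum_congr rfl fun j _ => ?_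
  have : star ((s i : ℝ) : ℂ) = s i := Complex.conj_ofReal _
  rw [star_mul', star_mul', this]
  push_cast
  ring

/-! ### Eigenbases and the main theorem -/

/-- A decreasing list is determined by its multiset, so `lam` is the sorted eigenvalue list that
indexes the eigenbasis. -/
theorem exists_orthonormalBasis_of_roots {ι : Type*} [Fintype ι] [DecidableEq ι]
    {A : Matrix ι ι ℂ} (hA : A.IsHermitian) {N : ℕ} (hN : Fintype.card ι = N) {lam : Fin N → ℝ}
    (hlam : Antitone lam)
    (hroots : A.charpoly.roots = Finset.univ.val.map (fun i => (lam i : ℂ))) :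
    ∃ b : OrthonormalBasis (Fin N) ℂ (EuclideanSpace ℂ ι),
      ∀ j, A.toEuclideanLin (b j) = (lam j : ℂ) • b j := by
  subst hN
  have h : hA.eigenvalues₀ = lam := by
    rw [← List.ofFn_inj, ← hA.sort_roots_charpoly_eq_eigenvalues₀, hroots]
    simp_rw [Fin.univ_val_map, Multiset.map_coe, List.map_ofFn, Function.comp_def,
      RCLike.re_to_complex, Complex.ofReal_re, Multiset.coe_sort]
    apply List.mergeSort_of_pairwise
    simp_rw [decide_eq_true_eq, ← List.sortedGE_iff_pairwise]
    exact hlam.sortedGE_ofFn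
  refine ⟨(Matrix.isSymmetric_toEuclideanLin_iff.mpr hA).eigenvectorBasis
    finrank_euclideanSpace, fun j => ?_⟩
  rw [LinearMap.IsSymmetric.apply_eigenvectorBasis, ← h]
  rfl

/-- Needed for vectors of Schmidt rank below `min n k`. A dropped index satisfies `i ≤ N - i`, so
dropping it lowers the left side at least as much as the right. -/
theorem sum_entry_le_of_le {N r t : ℕ} {x : Fin N → ℝ} (hx : Antitone x) (htr : t ≤ r)
    (hr : 2 * r ≤ N)
    (h : ∑ i ∈ Finset.Icc 1 r, entry x i
      ≤ 2 * entry x N + ∑ i ∈ Finset.Icc 1 r, entry x (N - i)) :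
    ∑ i ∈ Finset.Icc 1 t, entry x i
      ≤ 2 * entry x N + ∑ i ∈ Finset.Icc 1 t, entry x (N - i) := by
  have hsub : Finset.Icc 1 t ⊆ Finset.Icc 1 r := Finset.Icc_subset_Icc_right htr
  rw [← Finset.sum_sdiff hsub, ← Finset.sum_sdiff hsub] at h
  have h2 : ∑ i ∈ Finset.Icc 1 r \ Finset.Icc 1 t, entry x (N - i)
      ≤ ∑ i ∈ Finset.Icc 1 r \ Finset.Icc 1 t, entry x i := by
    refine Finset.sum_le_sum fun i hi => ?_
    have := Finset.mem_Icc.1 (Finset.mem_sdiff.1 hi).1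
    rw [entry, entry, dif_pos ⟨by omega, by omega⟩, dif_pos ⟨by omega, by omega⟩]
    exact hx (Fin.mk_le_mk.2 (by omega))
  linarith

theorem isHermitian_partialTranspose {n k : ℕ} {ρ : BipartiteMatrix n k} (h : ρ.IsHermitian) :
    (partialTranspose ρ).IsHermitian := by
  ext p q
  exact h.apply (p.1, q.2) (q.1, p.2)

theorem mem_PPT_of_gershgorinInequality {n k : ℕ} (hn : 2 ≤ n) (hk : 2 ≤ k)
    {ρ : BipartiteMatrix n k} (hρ : ρ ∈ densityOperators n k) {lam : Fin (n * k) → ℝ}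
    (hlam : Antitone lam) (hroots : IsEigenvalueVector ρ lam)
    (hger : GershgorinInequality n k lam) : ρ ∈ PPT n k := by
  refine ⟨hρ, .of_dotProduct_mulVec_nonneg (isHermitian_partialTranspose hρ.1.1) fun v => ?_⟩
  obtain ⟨b, hb⟩ := exists_orthonormalBasis_of_roots hρ.1.1 (by simp) hlam hroots
  obtain ⟨S, s, e, f, he, hf, hv⟩ := exists_schmidt_decomposition
    (Matrix.of fun a c => v (a, c))
  -- The Schmidt rank is at most `min n k`.
  have hSn := card_le_of_orthonormal (EuclideanSpace.basisFun (Fin n) ℂ) he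
  have hSk := card_le_of_orthonormal (EuclideanSpace.basisFun (Fin k) ℂ) hf
  have hN : 2 * (min n k - 1) ≤ n * k := by
    have : 2 * min n k ≤ n * k := Nat.mul_le_mul hn (min_le_right n k)
    omega
  have hpos := flip_form_nonneg b hb (Matrix.isSymmetric_toEuclideanLin_iff.mpr hρ.1.1) hlam
    (sum_entry_le_of_le hlam (by omega) hN hger) (orthonormal_conjProduct he hf) s
  rw [Complex.nonneg_iff]
  constructor
  · rw [dotProduct_partialTranspose ρ s e f v hv]
    simpa only [Complex.re_sum, Complex.re_ofReal_mul] using hpos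
  · exact ((isHermitian_partialTranspose hρ.1.1).im_star_dotProduct_mulVec_self v).symm

theorem mem_APPT_of_gershgorinInequality {n k : ℕ} (hn : 2 ≤ n) (hk : 2 ≤ k)
    {ρ : BipartiteMatrix n k} (hρ : ρ ∈ densityOperators n k) {lam : Fin (n * k) → ℝ}
    (hlam : Antitone lam) (hroots : IsEigenvalueVector ρ lam)
    (hger : GershgorinInequality n k lam) : ρ ∈ APPT n k := by
  simp only [APPT, Set.mem_iInter]
  intro U hU
  have hUU : U * U.conjTranspose = 1 := Matrix.mem_unitaryGroup_iff.1 hU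
  have hUU' : U.conjTranspose * U = 1 := Matrix.mem_unitaryGroup_iff'.1 hU
  -- The preimage of `ρ` under conjugation by `U` has the same characteristic polynomial, so the
  -- same `lam` serves.
  refine ⟨U.conjTranspose * ρ * U, mem_PPT_of_gershgorinInequality hn hk ⟨?_, ?_⟩ hlam ?_ hger, ?_⟩
  · exact hρ.1.conjTranspose_mul_mul_same U
  · rw [Matrix.trace_mul_comm, ← mul_assoc, hUU, one_mul, hρ.2]
  · rw [IsEigenvalueVector, Matrix.charpoly_mul_comm, ← mul_assoc, hUU, one_mul]
    exact hroots
  · change U * (U.conjTranspose * ρ * U) * U.conjTranspose = ρ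
    rw [← mul_assoc, ← mul_assoc, hUU, one_mul, mul_assoc, hUU, mul_one]

theorem IsEigenvalueVector.decr {n k : ℕ} {ρ : BipartiteMatrix n k} {x : Fin (n * k) → ℝ}
    (h : IsEigenvalueVector ρ x) : IsEigenvalueVector ρ (decr x) := by
  rw [IsEigenvalueVector] at h ⊢
  rw [h]
  conv_lhs => rw [← Multiset.map_univ_val_equiv (Tuple.sort fun i => -x i), Multiset.map_map]
  rfl

end AbsolutelyPPT

theorem mainTheorem5 (n k : ℕ) (hn : 2 ≤ n) (hk : 2 ≤ k) :
    (∀ ρ ∈ AbsolutelyPPT.densityOperators n k, ∀ lam : Fin (n * k) → ℝ,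
      Antitone lam → AbsolutelyPPT.IsEigenvalueVector ρ lam →
      ∑ i ∈ Finset.Icc 1 (min n k - 1), AbsolutelyPPT.entry lam i
        ≤ 2 * AbsolutelyPPT.entry lam (n * k)
          + ∑ i ∈ Finset.Icc 1 (min n k - 1), AbsolutelyPPT.entry lam (n * k - i) →
      ρ ∈ AbsolutelyPPT.APPT n k) ∧
    AbsolutelyPPT.statesWithSpectrumIn n k (AbsolutelyPPT.GER n k) ⊆
      AbsolutelyPPT.APPT n k := by
  refine ⟨fun ρ hρ lam hlam hroots hger =>
    AbsolutelyPPT.mem_APPT_of_gershgorinInequality hn hk hρ hlam hroots hger, ?_⟩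
  rintro ρ ⟨hρ, x, hx, hroots⟩
  exact AbsolutelyPPT.mem_APPT_of_gershgorinInequality hn hk hρ
    (AbsolutelyPPT.decr_antitone x) hroots.decr hx.2
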